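/- Let $p$ be a prime, let $K$ be a field extension of $\mathbf{Q}_p$ equipped with an ultrametric absolute value extending the $p$-adic one ($K$ need not be complete), and let $R=\{x\in K : |x|\le 1\}$ be its ring of integers. Let $\Lambda(R)=1+T R[[T]]$ be the ring of universal Witt vectors: its addition is the multiplication of power series, and its product is componentwise multiplication of ghost components, the $n$-th ghost component ($n\ge 1$) of $f$ being the coefficient of $T^n$ in $-Tf'(T)/f(T)$ (so that $\exp(\sum_{n\ge1} a_nT^n)$ has ghost components $-n a_n$, and the unit of the ring is $1-T$). Let $D\ge 1$ be an integer and, for $1\le n\le D$, put $d_n=\lfloor \log_p (D/n)\rfloor$. Assume that $R$ contains a root of unity $\zeta$ of order $p^{d_1+1}$, and put $\zeta_j=\zeta^{p^{d_1-j}}$ for $0\le j\le d_1$ (a root of unity of order $p^{j+1}$). Then the power series $$w=\exp\Big(\sum_{n=1}^{D}(\zeta_{d_n}-1)\frac{T^n}{n}\Big)$$ has all its coefficients in $R$, and the set of all series with coefficients in $R$ that are of the form $\exp(P(T))$, with $P\in K[T]$ of degree at most $D$ and $P(0)=0$, is exactly the ideal of $\Lambda(R)$ generated by $w$. Moreover this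 ideal is annihilated by the ideal $1+T^{D+1}R[[T]]$ of $\Lambda(R)$, and it is a free module of rank one over the quotient ring $\Lambda(R)/(1+T^{D+1}R[[T]])$. -/

import Mathlib

/-- The set `Λ(R) = 1 + T R[[T]]` of power series with constant coefficient `1`. -/
@[ext]
structure Lambda (R : Type*) [CommRing R] where
  /-- the underlying power series -/
  series : PowerSeries R
  constantCoeff_series : PowerSeries.constantCoeff series = 1

namespace Lambda

open PowerSeries

section Group

variable {R : Type*} [CommRing R]

/-- The inverse power series. -/
noncomputable def inv (f : Lambda R) : Lambda R :=
  ⟨invOfUnit f.series 1, by simp [constantCoeff_invOfUnit]⟩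

theorem series_mul_inv (f : Lambda R) : f.series * f.inv.series = 1 :=
  mul_invOfUnit _ _ (by simpa using f.constantCoeff_series)

/-- The addition of `Λ(R)` is the multiplication of power series. -/
noncomputable instance : Add (Lambda R) :=
  ⟨fun f g => ⟨f.series * g.series, by
    rw [map_mul, f.constantCoeff_series, g.constantCoeff_series, mul_one]⟩⟩

noncomputable instance : Zero (Lambda R) := ⟨⟨1, by simp⟩⟩

noncomputable instance : Neg (Lambda R) := ⟨inv⟩

theorem add_series (f g : Lambda R) : (f + g).series = f.series * g.series := rfl

theorem zero_series : (0 : Lambda R).series = 1 := rfl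

theorem series_mul_neg (f : Lambda R) : f.series * (-f).series = 1 := series_mul_inv f

noncomputable instance : AddCommGroup (Lambda R) where
  add_assoc f g h := Lambda.ext (by simp only [add_series, mul_assoc])
  zero_add f := Lambda.ext (by simp only [add_series, zero_series, one_mul])
  add_zero f := Lambda.ext (by simp only [add_series, zero_series, mul_one])
  add_comm f g := Lambda.ext (by simp only [add_series, mul_comm])
  neg_add_cancel f := Lambda.ext (by
    rw [add_series, zero_series, mul_comm, series_mul_neg])
  nsmul := nsmulRec
  zsmul := zsmulRec

/-- The power series `-T f'(T) / f(T)`, whose coefficient of `T ^ n` is the `n`-th ghost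
component of `f`. -/
noncomputable def ghostSeries (f : Lambda R) : PowerSeries R :=
  -(X * derivative R f.series * (-f).series)

/-- The ghost components of `f`: those of `exp (∑ aₙ Tⁿ)` are the `-n aₙ`. -/
noncomputable def ghost (f : Lambda R) : ℕ+ → R := fun n => coeff (n : ℕ) f.ghostSeries

theorem ghostSeries_mul (f : Lambda R) :
    f.ghostSeries * f.series = -(X * derivative R f.series) := by
  have h := series_mul_neg f
  rw [ghostSeries]
  linear_combination (-(X * derivative R f.series)) * h

theorem ghostSeries_eq (f : Lambda R) (q : PowerSeries R)
    (h : q * f.series = -(X * derivative R f.series)) : f.ghostSeries = q := by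
  have h1 := series_mul_neg f
  rw [ghostSeries]
  linear_combination (-(-f).series) * h + q * h1

theorem ghostSeries_add (f g : Lambda R) :
    (f + g).ghostSeries = f.ghostSeries + g.ghostSeries := by
  apply ghostSeries_eq
  have hf := ghostSeries_mul f
  have hg := ghostSeries_mul g
  rw [add_series, Derivation.leibniz, smul_eq_mul, smul_eq_mul]
  linear_combination g.series * hf + f.series * hg

/-- The ghost components as a homomorphism of additive groups. -/
noncomputable def ghostHom : Lambda R →+ (ℕ+ → R) :=
  AddMonoidHom.mk' ghost fun f g => by
    funext n
    simp only [ghost, ghostSeries_add, map_add, Pi.add_apply]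

theorem ghostHom_apply (f : Lambda R) : ghostHom f = ghost f := rfl

theorem coeff_zero_ghostSeries (f : Lambda R) : coeff 0 f.ghostSeries = 0 := by
  simp [ghostSeries]

/-- The series `1 - u T ^ n` for `n ≥ 1`. -/
noncomputable def elem (n : ℕ+) (u : R) : Lambda R :=
  ⟨1 - C u * X ^ (n : ℕ), by simp⟩

theorem ghost_elem (n : ℕ+) (u : R) (m : ℕ+) :
    ghost (elem n u) m = if (n : ℕ) ∣ m then (n : R) * u ^ ((m : ℕ) / n) else 0 := by
  have key : (elem n u).ghostSeries =
      PowerSeries.mk fun m => if m = 0 then 0 else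
        if (n : ℕ) ∣ m then (n : R) * u ^ (m / n) else 0 := by
    have hn := n.pos
    apply ghostSeries_eq
    have hd : X * derivative R (elem n u).series = -(C ((n : R) * u) * X ^ (n : ℕ)) := by
      simp only [elem, map_sub, Derivation.leibniz, derivative_one, derivative_C,
        Derivation.leibniz_pow, derivative_X, smul_eq_mul, nsmul_eq_mul, map_mul, mul_one,
        mul_zero, add_zero, zero_sub, map_natCast]
      obtain ⟨k, hk⟩ := Nat.exists_eq_add_of_lt hn
      rw [zero_add] at hk
      rw [hk, Nat.add_sub_cancel, pow_succ]
      ring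
    rw [hd, neg_neg]
    ext j
    rw [elem, mul_sub, mul_one, ← mul_assoc, map_sub, coeff_mul_X_pow', coeff_C_mul_X_pow,
      coeff_mul_C]
    simp only [coeff_mk]
    rcases lt_trichotomy j n with h | h | h
    · have h1 : ¬ (n : ℕ) ≤ j := by omega
      have h2 : j ≠ n := by omega
      rw [if_neg h1, if_neg h2]
      by_cases h0 : j = 0
      · simp [h0]
      · have : ¬ (n : ℕ) ∣ j := fun hh => h1 (Nat.le_of_dvd (by omega) hh)
        simp [this]
    · subst h
      simp [hn.ne', Nat.div_self hn]
    · have h1 : (n : ℕ) ≤ j := h.le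
      have h2 : j ≠ n := by omega
      have h3 : j - n ≠ 0 := by omega
      have h4 : j ≠ 0 := by omega
      rw [if_pos h1, if_neg h2, if_neg h3, if_neg h4]
      obtain ⟨i, rfl⟩ := Nat.exists_eq_add_of_le h1
      rw [Nat.add_sub_cancel_left]
      by_cases hi : (n : ℕ) ∣ i
      · rw [if_pos hi, if_pos ((Nat.dvd_add_right (dvd_refl _)).2 hi),
          Nat.add_div_left _ hn, pow_succ]
        ring
      · rw [if_neg hi, if_neg (fun hh => hi ((Nat.dvd_add_right (dvd_refl _)).1 hh))]
        ring
  rw [ghost, key, coeff_mk, if_neg m.pos.ne']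

/-- The unit of the ring `Λ(R)` is the series `1 - T`. -/
noncomputable instance : One (Lambda R) := ⟨⟨1 - X, by simp⟩⟩

theorem ghost_one : ghost (1 : Lambda R) = 1 := by
  have h : (1 : Lambda R) = elem 1 1 := Lambda.ext (by
    change 1 - X = 1 - C (1 : R) * X ^ ((1 : ℕ+) : ℕ)
    simp)
  funext m
  rw [h, ghost_elem]
  simp

theorem ghost_add (f g : Lambda R) : ghost (f + g) = ghost f + ghost g :=
  map_add ghostHom f g

theorem ghost_zero : ghost (0 : Lambda R) = 0 := map_zero ghostHom

/-- The subgroup generated by the series `1 - u T ^ n`. -/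
noncomputable def elemClosure (R : Type*) [CommRing R] : AddSubgroup (Lambda R) :=
  AddSubgroup.closure (Set.range fun x : ℕ+ × R => elem x.1 x.2)

theorem exists_elemClosure (f : Lambda R) (N : ℕ) :
    ∃ g ∈ elemClosure R, X ^ (N + 1) ∣ f.series - g.series := by
  induction N with
  | zero =>
    refine ⟨0, zero_mem _, ?_⟩
    rw [X_pow_dvd_iff]
    intro m hm
    obtain rfl : m = 0 := by omega
    rw [coeff_zero_eq_constantCoeff_apply, map_sub, f.constantCoeff_series,
      Lambda.constantCoeff_series, sub_self]
  | succ N ih =>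
    obtain ⟨g, hg, q, hq⟩ := ih
    refine ⟨g + elem ⟨N + 1, N.succ_pos⟩ (-constantCoeff q), add_mem hg
      (AddSubgroup.subset_closure ⟨(⟨N + 1, N.succ_pos⟩, -constantCoeff q), rfl⟩), ?_⟩
    have h1 : X ∣ q - C (constantCoeff q) * g.series := by
      rw [X_dvd_iff, map_sub, map_mul, g.constantCoeff_series]
      simp
    obtain ⟨r, hr⟩ := h1
    refine ⟨r, ?_⟩
    simp only [add_series, elem, PNat.mk_coe, map_neg]
    linear_combination hq + X ^ (N + 1) * hr

theorem elemClosure_mul (f g : Lambda R) (hf : f ∈ elemClosure R) (hg : g ∈ elemClosure R) :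
    ghost f * ghost g ∈ (ghostHom (R := R)).range := by
  change ghostHom f * ghostHom g ∈ _
  induction hf using AddSubgroup.closure_induction with
  | zero => rw [map_zero, zero_mul]; exact zero_mem _
  | add x y _ _ hx hy => rw [map_add, add_mul]; exact add_mem hx hy
  | neg x _ hx => rw [map_neg, neg_mul]; exact neg_mem hx
  | mem x hx =>
    obtain ⟨⟨n, u⟩, rfl⟩ := hx
    induction hg using AddSubgroup.closure_induction with
    | zero => rw [map_zero, mul_zero]; exact zero_mem _
    | add x y _ _ hx hy => rw [map_add, mul_add]; exact add_mem hx hy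
    | neg x _ hx => rw [map_neg, mul_neg]; exact neg_mem hx
    | mem y hy =>
      obtain ⟨⟨k, v⟩, rfl⟩ := hy
      have hl : 0 < Nat.lcm n k := Nat.lcm_pos n.pos k.pos
      obtain ⟨l, hl'⟩ : ∃ l : ℕ+, (l : ℕ) = Nat.lcm n k := ⟨Nat.toPNat _ hl, rfl⟩
      refine ⟨Nat.gcd n k • elem l
        (u ^ (Nat.lcm n k / n) * v ^ (Nat.lcm n k / k)), ?_⟩
      rw [map_nsmul]
      funext m
      simp only [Pi.smul_apply, Pi.mul_apply, ghostHom_apply, ghost_elem, hl']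
      by_cases h : Nat.lcm n k ∣ m
      · have hn : (n : ℕ) ∣ m := (Nat.dvd_lcm_left _ _).trans h
        have hk : (k : ℕ) ∣ m := (Nat.dvd_lcm_right _ _).trans h
        rw [if_pos h, if_pos hn, if_pos hk, nsmul_eq_mul, mul_pow, ← pow_mul, ← pow_mul,
          Nat.div_mul_div_comm (Nat.dvd_lcm_left _ _) h,
          Nat.div_mul_div_comm (Nat.dvd_lcm_right _ _) h,
          mul_comm (n : ℕ), mul_comm (k : ℕ), Nat.mul_div_mul_left _ _ hl,
          Nat.mul_div_mul_left _ _ hl]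
        have := congrArg (Nat.cast (R := R)) (Nat.gcd_mul_lcm n k)
        push_cast at this
        linear_combination (u ^ ((m : ℕ) / n) * v ^ ((m : ℕ) / k)) * this
      · rw [if_neg h, smul_zero]
        by_cases hn : (n : ℕ) ∣ m
        · have hk : ¬ (k : ℕ) ∣ m := fun hk => h (Nat.lcm_dvd hn hk)
          rw [if_neg hk, mul_zero]
        · rw [if_neg hn, zero_mul]

end Group

section Ring

variable {R : Type*} [CommRing R] [IsAddTorsionFree R]

theorem ghost_eq_zero_iff (f : Lambda R) (N : ℕ) :
    (∀ n : ℕ+, (n : ℕ) ≤ N → ghost f n = 0) ↔ X ^ (N + 1) ∣ f.series - 1 := by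
  have h1 : (∀ n : ℕ+, (n : ℕ) ≤ N → ghost f n = 0) ↔ X ^ (N + 1) ∣ f.ghostSeries := by
    rw [X_pow_dvd_iff]
    refine ⟨fun h m hm => ?_, fun h n hn => h n (by omega)⟩
    rcases Nat.eq_zero_or_pos m with rfl | h0
    · exact coeff_zero_ghostSeries f
    · exact h ⟨m, h0⟩ (by simpa using Nat.lt_succ_iff.1 hm)
  have h2 : X ^ (N + 1) ∣ X * derivative R f.series ↔ X ^ (N + 1) ∣ f.series - 1 := by
    rw [X_pow_dvd_iff, X_pow_dvd_iff]
    refine forall_congr' fun m => imp_congr_right fun _ => ?_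
    rcases m with _ | m
    · simp [f.constantCoeff_series]
    · rw [coeff_succ_X_mul, coeff_derivative, map_sub, coeff_one, if_neg (by omega), sub_zero,
        mul_comm, ← Nat.cast_succ, ← nsmul_eq_mul, nsmul_eq_zero_iff_right (by omega)]
  rw [h1, ← h2]
  constructor
  · intro h
    rw [← dvd_neg, ← ghostSeries_mul]
    exact h.mul_right _
  · intro h
    exact (h.mul_right _).neg_right

theorem ghost_eq_iff (f g : Lambda R) (N : ℕ) :
    (∀ n : ℕ+, (n : ℕ) ≤ N → ghost f n = ghost g n) ↔
      X ^ (N + 1) ∣ f.series - g.series := by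
  have h1 : ∀ n, ghost (f - g) n = ghost f n - ghost g n := fun n =>
    congrFun (map_sub ghostHom f g) n
  have h2 := ghost_eq_zero_iff (f - g) N
  simp only [h1, sub_eq_zero] at h2
  rw [h2, sub_eq_add_neg f g, add_series]
  have h3 := series_mul_neg g
  constructor
  · rintro ⟨q, hq⟩
    exact ⟨q * g.series, by linear_combination g.series * hq - f.series * h3⟩
  · rintro ⟨q, hq⟩
    exact ⟨q * (-g).series, by linear_combination (-g).series * hq + h3⟩

theorem ghost_injective : Function.Injective (ghost (R := R)) := by
  intro f g h
  apply Lambda.ext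
  ext n
  rw [← sub_eq_zero, ← map_sub]
  exact X_pow_dvd_iff.1 ((ghost_eq_iff f g n).1 fun m _ => congrFun h m) n (by omega)

theorem exists_of_approx (x : ℕ+ → R)
    (h : ∀ N : ℕ, ∃ f : Lambda R, ∀ n : ℕ+, (n : ℕ) ≤ N → ghost f n = x n) :
    ∃ f : Lambda R, ghost f = x := by
  choose F hF using h
  have hc : ∀ n N, n ≤ N → coeff n (F N).series = coeff n (F n).series := by
    intro n N hnN
    rw [← sub_eq_zero, ← map_sub]
    refine X_pow_dvd_iff.1 ((ghost_eq_iff (F N) (F n) n).1 fun m hm => ?_) n (by omega)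
    rw [hF N m (hm.trans hnN), hF n m hm]
  refine ⟨⟨PowerSeries.mk fun n => coeff n (F n).series, ?_⟩, ?_⟩
  · rw [← coeff_zero_eq_constantCoeff_apply, coeff_mk, coeff_zero_eq_constantCoeff_apply,
      (F 0).constantCoeff_series]
  · funext n
    rw [← hF n n le_rfl]
    refine (ghost_eq_iff _ (F n) n).2 ?_ n le_rfl
    rw [X_pow_dvd_iff]
    intro m hm
    rw [map_sub, coeff_mk, hc m n (by omega), sub_self]

theorem exists_ghost_mul (f g : Lambda R) : ∃ h : Lambda R, ghost h = ghost f * ghost g := by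
  apply exists_of_approx
  intro N
  obtain ⟨f', hf', hf⟩ := exists_elemClosure f N
  obtain ⟨g', hg', hg⟩ := exists_elemClosure g N
  obtain ⟨h, hh⟩ := elemClosure_mul f' g' hf' hg'
  refine ⟨h, fun n hn => ?_⟩
  rw [← ghostHom_apply, hh, Pi.mul_apply, Pi.mul_apply, (ghost_eq_iff f f' N).2 hf n hn,
    (ghost_eq_iff g g' N).2 hg n hn]

/-- The product of `Λ(R)`: the unique element whose ghost components are the products of those
of the two factors. -/
noncomputable instance : Mul (Lambda R) := ⟨fun f g => (exists_ghost_mul f g).choose⟩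

theorem ghost_mul (f g : Lambda R) : ghost (f * g) = ghost f * ghost g :=
  (exists_ghost_mul f g).choose_spec

/-- The ring `Λ(R)` of universal Witt vectors over a torsion-free ring `R`: the addition is the
multiplication of power series, and the product is the product of ghost components. -/
noncomputable instance : CommRing (Lambda R) where
  mul_assoc f g h := ghost_injective (by simp only [ghost_mul, mul_assoc])
  one_mul f := ghost_injective (by simp only [ghost_mul, ghost_one, one_mul])
  mul_one f := ghost_injective (by simp only [ghost_mul, ghost_one, mul_one])
  mul_comm f g := ghost_injective (by simp only [ghost_mul, mul_comm])
  left_distrib f g h := ghost_injective (by simp only [ghost_mul, ghost_add, mul_add])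
  right_distrib f g h := ghost_injective (by simp only [ghost_mul, ghost_add, add_mul])
  zero_mul f := ghost_injective (by simp only [ghost_mul, ghost_zero, zero_mul])
  mul_zero f := ghost_injective (by simp only [ghost_mul, ghost_zero, mul_zero])
  zsmul := zsmulRec
  neg_add_cancel := neg_add_cancel

/-- The ideal `1 + T ^ (D + 1) R[[T]]` of the ring `Λ(R)`. -/
noncomputable def tail (R : Type*) [CommRing R] [IsAddTorsionFree R] (D : ℕ) :
    Ideal (Lambda R) where
  carrier := {f | X ^ (D + 1) ∣ f.series - 1}
  zero_mem' := by simp [zero_series]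
  add_mem' := by
    rintro f g ⟨a, ha⟩ ⟨b, hb⟩
    refine ⟨a * g.series + b, ?_⟩
    rw [add_series]
    linear_combination g.series * ha + hb
  smul_mem' := by
    intro c f hf
    refine (ghost_eq_zero_iff _ D).1 fun n hn => ?_
    rw [smul_eq_mul, ghost_mul, Pi.mul_apply, (ghost_eq_zero_iff f D).2 hf n hn, mul_zero]

end Ring

end Lambda

/-- The power series `exp(P(T))`, for a polynomial `P` with zero constant term. -/
noncomputable def expPoly {K : Type*} [Field K] [CharZero K] (P : Polynomial K) :
    PowerSeries K :=
  (PowerSeries.exp K).subst (P : PowerSeries K)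

/-- The ring of integers `{x | ‖x‖ ≤ 1}` of an ultrametric field. -/
noncomputable abbrev integers (K : Type*) [NormedField K] [IsUltrametricDist K] : Subring K :=
  (NormedField.valuation (K := K)).integer

/-- The polynomial `∑_{n=1}^{D} (ζ_{dₙ} - 1) Xⁿ / n`, where `dₙ = ⌊log_p (D / n)⌋` and
`ζ_j = ζ ^ (p ^ (d₁ - j))`, which has order `p ^ (j + 1)` if `ζ` has order `p ^ (d₁ + 1)`. -/
noncomputable def generatorExponent {K : Type*} [Field K] (p D : ℕ) (ζ : K) : Polynomial K :=
  ∑ n ∈ Finset.Icc 1 D,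
    Polynomial.monomial n ((ζ ^ p ^ (Nat.log p D - Nat.log p (D / n)) - 1) / (n : K))

/-! Since $R$ is torsion-free, ghost components are injective, and $\exp(P)$ has $n$-th ghost
component $-nP_n$ (`map_series_eq_expPoly_iff`). The set in question is therefore the set of
$f\in\Lambda(R)$ whose ghost components vanish beyond $D$, and $w$ must have components
$1-\zeta_{d_n}$ for $n\le D$ and $0$ beyond.

Integrality of $w$ (`exists_ghost_eq_one_sub_pow`): integers prime to $p$ are units of $R$, so the
indicator of each class $\{m_0p^k\}$ with $p\nmid m_0$ is the ghost vector of an idempotent. On each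
class $w$ is this idempotent times $1-[\xi]$, where $\xi$ is a root of unity of $p$-power order and
$[\xi]$ is the series $1-\xi T$, with components $\xi^m$. The vanishing beyond $D$ is the relation
$\xi^{m}=1$.

Generation (`mem_span_of_ghost_eq_zero`): if the first nonzero component of $f$ is at $n\le D$, it
equals $nc$ with $c\in R$. A multiple of $w$ removes it as soon as $1-\zeta_d$ divides $c$, where
$d=d_n$. As $|1-\zeta_d|^{p^d(p-1)}=1/p$ (`norm_one_sub_pow_eq`), it suffices that
$|c|^{p^d(p-1)}\le 1/p$. Frobenius and Verschiebung arguments (`exists_natCast_mul_pow_eq_add`) give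
$(uc)^{p^d}\equiv x \bmod p$ with $u$ prime to $p$, where $x$ is the first component of a series
with zero components at $p,p^2,\dots$, as far as needed. The $p$-typical part of that series agrees
with $\exp(-xT)$ to high order, so $x^{p^j}/(p^j)!\in R$ for all $j$, whence $|x|^{p-1}\le 1/p$. All
approximation is $T$-adic, so $K$ need not be complete.

Finally $1-\zeta_{d_n}\ne0$ for $n\le D$, so the annihilator of $w$ is exactly $1+T^{D+1}R[[T]]$,
which gives freeness. -/

namespace Lambda

open PowerSeries

section Elem

variable {R : Type*} [CommRing R]

theorem ghost_elem_of_lt {n m : ℕ+} (h : m < n) (u : R) : ghost (elem n u) m = 0 := by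
  rw [ghost_elem]
  exact if_neg fun hd => absurd (Nat.le_of_dvd m.pos hd) (not_le.2 h)

theorem ghost_elem_self (n : ℕ+) (u : R) : ghost (elem n u) n = n * u := by
  rw [ghost_elem, if_pos dvd_rfl, Nat.div_self n.pos, pow_one]

theorem ghost_elem_one (u : R) (m : ℕ+) : ghost (elem 1 u) m = u ^ (m : ℕ) := by
  rw [ghost_elem, if_pos (by simp)]
  simp

end Elem

/-! ### Constructing Witt vectors with prescribed ghost components -/

section Existence

variable {R : Type*} [CommRing R] [IsAddTorsionFree R]

/-- The ghost components as a homomorphism of rings. -/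
noncomputable def ghostRingHom : Lambda R →+* (ℕ+ → R) where
  toFun := ghost
  map_one' := ghost_one
  map_mul' := ghost_mul
  map_zero' := ghost_zero
  map_add' := ghost_add

theorem ghost_sub (f g : Lambda R) : ghost (f - g) = ghost f - ghost g :=
  map_sub ghostRingHom f g

theorem ghost_nsmul (n : ℕ) (f : Lambda R) : ghost (n • f) = n • ghost f :=
  map_nsmul ghostRingHom n f

theorem ghost_sum {ι : Type*} (s : Finset ι) (f : ι → Lambda R) (n : ℕ+) :
    ghost (∑ i ∈ s, f i) n = ∑ i ∈ s, ghost (f i) n := by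
  have := congrFun (map_sum ghostRingHom f s) n
  rwa [Finset.sum_apply] at this

theorem ghost_prod {ι : Type*} (s : Finset ι) (f : ι → Lambda R) (n : ℕ+) :
    ghost (∏ i ∈ s, f i) n = ∏ i ∈ s, ghost (f i) n := by
  have := congrFun (map_prod ghostRingHom f s) n
  rwa [Finset.prod_apply] at this

theorem natCast_mul_cancel {n : ℕ} (hn : n ≠ 0) {a b : R} (h : (n : R) * a = n * b) : a = b := by
  rw [← nsmul_eq_mul, ← nsmul_eq_mul] at h
  exact nsmul_right_injective hn h

/-- The first nonzero ghost component is a multiple of its index. -/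
theorem exists_ghost_eq_natCast_mul (f : Lambda R) (n : ℕ+) (h : ∀ m < n, ghost f m = 0) :
    ∃ c : R, ghost f n = n * c := by
  -- Modulo $T^{n+1}$ the series is $1+aT^n$, the same as the elementary series with parameter $-a$.
  refine ⟨-coeff n f.series, ?_⟩
  obtain ⟨N, hN⟩ : ∃ N, (n : ℕ) = N + 1 := ⟨n - 1, by have := n.pos; omega⟩
  have h1 : X ^ (N + 1) ∣ f.series - 1 :=
    (ghost_eq_zero_iff f N).1 fun m hm => h m (PNat.coe_lt_coe _ _ |>.1 (by omega))
  have h2 : X ^ ((n : ℕ) + 1) ∣ f.series - (elem n (-coeff n f.series)).series := by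
    rw [X_pow_dvd_iff] at h1 ⊢
    intro m hm
    rcases Nat.lt_succ_iff_lt_or_eq.1 hm with hm | rfl
    · have := h1 m (by omega)
      simpa [elem, coeff_X_pow, hm.ne] using this
    · simp [elem, coeff_X_pow, coeff_one]
  rw [(ghost_eq_iff _ _ _).2 h2 n le_rfl, ghost_elem, if_pos dvd_rfl, Nat.div_self n.pos, pow_one]

/-- Successive approximation of the ghost components by elements of a subgroup. -/
theorem exists_mem_ghost_eq (S : AddSubgroup (Lambda R)) (f : Lambda R) (n₀ : ℕ)
    (h₀ : ∀ m : ℕ+, (m : ℕ) ≤ n₀ → ghost f m = 0)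
    (step : ∀ n : ℕ+, n₀ < n → ∀ g ∈ S, (∀ m < n, ghost (f - g) m = 0) →
      ∃ s ∈ S, ∀ m ≤ n, ghost s m = ghost (f - g) m) (N : ℕ) :
    ∃ g ∈ S, ∀ m : ℕ+, (m : ℕ) ≤ N → ghost g m = ghost f m := by
  induction N with
  | zero => exact ⟨0, zero_mem _, fun m hm => absurd m.pos (by omega)⟩
  | succ N ih =>
    by_cases hN : N + 1 ≤ n₀
    · exact ⟨0, zero_mem _, fun m hm => by rw [h₀ m (hm.trans hN), ghost_zero, Pi.zero_apply]⟩
    · obtain ⟨g, hg, hgf⟩ := ih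
      obtain ⟨s, hs, hsf⟩ := step ⟨N + 1, N.succ_pos⟩ (by simpa using hN) g hg fun m hm => by
        rw [ghost_sub, Pi.sub_apply, hgf m (Nat.lt_succ_iff.1 hm), sub_self]
      refine ⟨g + s, add_mem hg hs, fun m hm => ?_⟩
      rw [ghost_add, Pi.add_apply, hsf m hm, ghost_sub, Pi.sub_apply, add_sub_cancel]

/-- The ghost components of a series are approximated by those of combinations of the
`1 - u T ^ n`, where `n` exceeds the number of leading zeros. -/
theorem exists_closure_ghost_eq (f : Lambda R) (n₀ : ℕ)
    (h₀ : ∀ m : ℕ+, (m : ℕ) ≤ n₀ → ghost f m = 0) (N : ℕ) :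
    ∃ g ∈ AddSubgroup.closure {x : Lambda R | ∃ (n : ℕ+) (u : R), n₀ < n ∧ x = elem n u},
      ∀ m : ℕ+, (m : ℕ) ≤ N → ghost g m = ghost f m := by
  refine exists_mem_ghost_eq _ f n₀ h₀ (fun n hn g _ hz => ?_) N
  obtain ⟨c, hc⟩ := exists_ghost_eq_natCast_mul _ n hz
  refine ⟨elem n c, AddSubgroup.subset_closure ⟨n, c, hn, rfl⟩, fun m hm => ?_⟩
  rcases hm.lt_or_eq with hm | rfl
  · rw [hz m hm, ghost_elem_of_lt hm]
  · rw [hc, ghost_elem_self]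

/-- A unit $r$ of $R$ can be divided out in $\Lambda(R)$: a leading component $nc$ is $r$ times the
leading component of `elem n (r⁻¹ c)`, so every $f$ is approximated by $r$-multiples. -/
theorem exists_natCast_mul_ghost_eq (f : Lambda R) {r : ℕ} (hr : IsUnit (r : R)) :
    ∃ g : Lambda R, ∀ m, (r : R) * ghost g m = ghost f m := by
  obtain ⟨u, hu⟩ := hr
  suffices h : ∃ g : Lambda R, ghost g = fun m => ↑u⁻¹ * ghost f m by
    obtain ⟨g, hg⟩ := h
    exact ⟨g, fun m => by rw [hg, ← hu, Units.mul_inv_cancel_left]⟩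
  apply exists_of_approx
  intro N
  obtain ⟨_, ⟨g, rfl⟩, hg⟩ := exists_mem_ghost_eq
    (nsmulAddMonoidHom (α := Lambda R) r).range f 0 (fun m hm => absurd m.pos (by omega))
    (by
      rintro n - g - hz
      obtain ⟨c, hc⟩ := exists_ghost_eq_natCast_mul _ n hz
      refine ⟨_, ⟨elem n (↑u⁻¹ * c), rfl⟩, fun m hm => ?_⟩
      rw [nsmulAddMonoidHom_apply, ghost_nsmul, Pi.smul_apply, nsmul_eq_mul, ← hu]
      rcases hm.lt_or_eq with hm | rfl
      · rw [hz m hm, ghost_elem_of_lt hm, mul_zero]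
      · rw [hc, ghost_elem_self, mul_left_comm, Units.mul_inv_cancel_left]) N
  refine ⟨g, fun n hn => ?_⟩
  rw [← hg n hn, nsmulAddMonoidHom_apply, ghost_nsmul, Pi.smul_apply, nsmul_eq_mul, ← hu,
    Units.inv_mul_cancel_left]

/-- The Frobenius operators. -/
theorem exists_ghost_eq_ghost_mul (f : Lambda R) (r : ℕ+) :
    ∃ g : Lambda R, ghost g = fun m => ghost f (r * m) := by
  apply exists_of_approx
  intro N
  obtain ⟨f', hf', hN⟩ := exists_closure_ghost_eq f 0 (fun m hm => absurd m.pos (by omega)) (r * N)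
  suffices h : ∃ g : Lambda R, ∀ m, ghost g m = ghost f' (r * m) by
    obtain ⟨g, hg⟩ := h
    exact ⟨g, fun n hn => by rw [hg, hN _ (by rw [PNat.mul_coe]; exact Nat.mul_le_mul_left _ hn)]⟩
  clear hN
  induction hf' using AddSubgroup.closure_induction with
  | zero => exact ⟨0, fun m => by simp [ghost_zero]⟩
  | add x y _ _ hx hy =>
    obtain ⟨a, ha⟩ := hx
    obtain ⟨b, hb⟩ := hy
    exact ⟨a + b, fun m => by simp only [ghost_add, Pi.add_apply, ha, hb]⟩
  | neg x _ hx =>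
    obtain ⟨a, ha⟩ := hx
    exact ⟨0 - a, fun m => by
      rw [← zero_sub x, ghost_sub, ghost_sub, ghost_zero, Pi.sub_apply, Pi.sub_apply, ha]; rfl⟩
  | mem x hx =>
    obtain ⟨n, u, -, rfl⟩ := hx
    have hg : 0 < Nat.gcd n r := Nat.gcd_pos_of_pos_left _ n.pos
    obtain ⟨n', r', hco, hn, hr⟩ := Nat.exists_coprime (n : ℕ) r
    generalize Nat.gcd n r = g at *
    have hn' : 0 < n' := Nat.pos_of_ne_zero (by rintro rfl; have := n.pos; omega)
    lift n' to ℕ+ using hn'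
    -- The classical formula: with $g=\gcd(n,r)$, the $r$-th Frobenius sends $1-uT^n$ to the $g$-th
    -- power of $1-u^{r/g}T^{n/g}$.
    refine ⟨g • elem n' (u ^ r'), fun m => ?_⟩
    rw [ghost_nsmul, Pi.smul_apply, ghost_elem, ghost_elem, PNat.mul_coe, hn, hr,
      mul_right_comm]
    have hiff : (n' : ℕ) * g ∣ r' * m * g ↔ (n' : ℕ) ∣ m := by
      rw [Nat.mul_dvd_mul_iff_right hg, hco.dvd_mul_left]
    simp only [hiff]
    split_ifs with hd
    · obtain ⟨k, hk⟩ := hd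
      rw [hk, Nat.mul_div_cancel_left _ n'.pos, Nat.mul_div_mul_right _ _ hg, ← pow_mul,
        mul_left_comm, Nat.mul_div_cancel_left _ n'.pos, nsmul_eq_mul]
      push_cast
      ring
    · rw [smul_zero]

/-- The indicator function of the multiples of an invertible integer is a ghost vector. -/
theorem exists_ghost_eq_indicator_dvd (n : ℕ+) (hn : IsUnit ((n : ℕ) : R)) :
    ∃ g : Lambda R, ∀ m : ℕ+, ghost g m = if (n : ℕ) ∣ m then 1 else 0 := by
  obtain ⟨g, hg⟩ := exists_natCast_mul_ghost_eq (elem n (1 : R)) hn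
  refine ⟨g, fun m => hn.mul_left_cancel ?_⟩
  rw [hg, ghost_elem]
  simp

end Existence

/-! ### Ghost components along powers of a prime -/

section Prime

/-- A truncated exponential. -/
theorem coeff_mul_factorial {R : Type*} [CommRing R] (f : Lambda R) (N : ℕ)
    (h : ∀ m : ℕ+, 1 < m → (m : ℕ) ≤ N → ghost f m = 0) (k : ℕ) (hk : k ≤ N) :
    coeff k f.series * (k.factorial : R) = (-ghost f 1) ^ k := by
  induction k with
  | zero => simp [f.constantCoeff_series]
  | succ k ih =>
    -- Up to degree $N$ the series satisfies $f'=-xf$ with $x$ its first ghost component, which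
    -- gives the recursion $(k+1)a_{k+1}=-xa_k$.
    have h1 : X ^ (N + 1) ∣ f.ghostSeries - C (ghost f 1) * X := by
      rw [X_pow_dvd_iff]
      intro m hm
      rcases m with _ | _ | m
      · rw [map_sub, coeff_zero_ghostSeries]
        simp
      · simp [ghost]
      · have := h ⟨m + 2, by omega⟩ (PNat.coe_lt_coe _ _ |>.1 (by simp)) (Nat.lt_succ_iff.1 hm)
        simp only [ghost, PNat.mk_coe] at this
        rw [map_sub, this, coeff_C_mul, coeff_X, if_neg (by omega), mul_zero, sub_zero]
    obtain ⟨q, hq⟩ := h1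
    have h2 := ghostSeries_mul f
    rw [sub_eq_iff_eq_add.1 hq] at h2
    have h3 := congrArg (coeff (k + 1)) h2
    rw [add_mul, mul_assoc, mul_assoc, map_add, coeff_X_pow_mul', if_neg (by omega), coeff_C_mul,
      coeff_succ_X_mul, map_neg, coeff_succ_X_mul, coeff_derivative] at h3
    rw [Nat.factorial_succ, pow_succ, ← ih (by omega)]
    push_cast
    linear_combination (k.factorial : R) * h3

variable {R : Type*} [CommRing R] [IsAddTorsionFree R]

/-- A combination of Frobenius, Verschiebung and projection to the `p`-typical part. -/
theorem exists_ghost_prime_pow_eq (p : ℕ+) (hp : (p : ℕ).Prime) (f : Lambda R) (n₀ : ℕ+) (a : ℕ)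
    (hn₀ : Nat.Coprime n₀ p) (h₀ : ∀ m < n₀ * p ^ a, ghost f m = 0) (N : ℕ) :
    ∃ h : Lambda R, ∀ k ≤ N,
      ((p ^ a : ℕ) : R) * ghost h (p ^ k) = ghost f (n₀ * p ^ (a + k)) := by
  obtain ⟨f', hf', hN⟩ := exists_closure_ghost_eq f (n₀ * p ^ a - 1)
    (fun m hm => h₀ m (by
      have := (n₀ * p ^ a).pos
      rw [← PNat.coe_lt_coe]
      push_cast at this ⊢
      omega)) (n₀ * p ^ (a + N))
  suffices h : ∃ h : Lambda R, ∀ k,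
      ((p ^ a : ℕ) : R) * ghost h (p ^ k) = ghost f' (n₀ * p ^ (a + k)) by
    obtain ⟨h, hh⟩ := h
    refine ⟨h, fun k hk => ?_⟩
    rw [hh, hN]
    push_cast
    exact Nat.mul_le_mul_left _ (Nat.pow_le_pow_right p.pos (by omega))
  clear hN
  induction hf' using AddSubgroup.closure_induction with
  | zero => exact ⟨0, fun m => by simp [ghost_zero]⟩
  | add x y _ _ hx hy =>
    obtain ⟨a, ha⟩ := hx
    obtain ⟨b, hb⟩ := hy
    exact ⟨a + b, fun m => by simp only [ghost_add, Pi.add_apply, mul_add, ha, hb]⟩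
  | neg x _ hx =>
    obtain ⟨a, ha⟩ := hx
    exact ⟨0 - a, fun m => by
      rw [← zero_sub x, ghost_sub, ghost_sub, ghost_zero, Pi.sub_apply, Pi.sub_apply, mul_sub, ha]
      simp⟩
  | mem x hx =>
    obtain ⟨j, u, hj, rfl⟩ := hx
    obtain ⟨b, j₀, hj₀, hjb⟩ := Nat.exists_eq_pow_mul_and_not_dvd j.ne_zero p hp.ne_one
    have hco : Nat.Coprime j₀ p := ((Nat.Prime.coprime_iff_not_dvd hp).2 hj₀).symm
    have hj₀' : 0 < j₀ := Nat.pos_of_ne_zero (by rintro rfl; simp at hj₀)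
    have hpa : 0 < (p : ℕ) ^ a := pow_pos p.pos a
    by_cases hd : j₀ ∣ n₀
    · obtain ⟨q, hq⟩ := hd
      have hcq : Nat.Coprime q p := hn₀.coprime_dvd_left ⟨j₀, by rw [hq, mul_comm]⟩
      -- If $b<a$, then $j_0\le n_0$ would force $j=p^bj_0<n_0p^a$, contradicting that only indices
      -- $j\ge n_0p^a$ occur. This is where the vanishing of the earlier components is used.
      have hab : a ≤ b := by
        by_contra hab
        have h1 : (p : ℕ) ^ b * p ≤ p ^ a := by
          rw [← pow_succ]
          exact Nat.pow_le_pow_right p.pos (by omega)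
        have h2 : j₀ ≤ n₀ := Nat.le_of_dvd n₀.pos ⟨q, hq⟩
        have h3 := hp.two_le
        have h4 : (p : ℕ) ^ b < p ^ a := by
          have : 0 < (p : ℕ) ^ b := pow_pos p.pos b
          nlinarith
        have h5 : (p : ℕ) ^ b * j₀ < p ^ a * n₀ := by nlinarith
        rw [← hjb, mul_comm ((p : ℕ) ^ a)] at h5
        omega
      obtain ⟨i, rfl⟩ := Nat.exists_eq_add_of_le hab
      refine ⟨j₀ • elem (p ^ i) (u ^ q), fun k => ?_⟩
      rw [ghost_nsmul, Pi.smul_apply, ghost_elem, ghost_elem]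
      have e1 : (j : ℕ) = j₀ * p ^ a * p ^ i := by rw [hjb, pow_add]; ring
      have e2 : ((n₀ * p ^ (a + k) : ℕ+) : ℕ) = j₀ * p ^ a * (q * p ^ k) := by
        push_cast
        rw [hq, pow_add]
        ring
      have hpos : 0 < j₀ * (p : ℕ) ^ a := Nat.mul_pos hj₀' hpa
      have hiff : (j : ℕ) ∣ ((n₀ * p ^ (a + k) : ℕ+) : ℕ) ↔
          ((p ^ i : ℕ+) : ℕ) ∣ ((p ^ k : ℕ+) : ℕ) := by
        rw [e1, e2, Nat.mul_dvd_mul_iff_left hpos, PNat.pow_coe, PNat.pow_coe,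
          (hcq.symm.pow_left i).dvd_mul_left]
      simp only [hiff]
      split_ifs with hd
      · obtain ⟨c, hc⟩ := hd
        rw [e1, e2, Nat.mul_div_mul_left _ _ hpos, hc, Nat.mul_div_cancel_left _ (p ^ i).pos,
          ← PNat.pow_coe p k, hc, mul_left_comm q, ← PNat.pow_coe p i,
          Nat.mul_div_cancel_left _ (p ^ i).pos, ← pow_mul, nsmul_eq_mul]
        push_cast
        ring
      · simp
    · refine ⟨0, fun k => ?_⟩
      rw [ghost_zero, Pi.zero_apply, mul_zero, ghost_elem]
      refine (if_neg fun h => hd ?_).symm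
      rw [hjb] at h
      have h1 := (dvd_mul_left j₀ _).trans h
      push_cast at h1
      exact (hco.pow_right _).dvd_of_dvd_mul_right h1

/-- Both sides are additive modulo $p$, so elementary series suffice: for $1-uT$ the congruence is
an equality, and for index $j>1$ a nonzero component at $p^d$ is a multiple of $j$, itself a
positive power of $p$. -/
theorem exists_ghost_prime_pow_eq_pow_add (p : ℕ+) (hp : (p : ℕ).Prime) (f : Lambda R) (d : ℕ) :
    ∃ r : R, ghost f (p ^ d) = ghost f 1 ^ (p : ℕ) ^ d + p * r := by
  obtain ⟨f', hf', hN⟩ := exists_closure_ghost_eq f 0 (fun m hm => absurd m.pos (by omega))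
    (p ^ d : ℕ+)
  rw [← hN 1 (p ^ d).pos, ← hN (p ^ d) le_rfl]
  clear hN
  have hadd : ∀ a b : R, ∃ r, (a + b) ^ (p : ℕ) ^ d = a ^ (p : ℕ) ^ d + b ^ (p : ℕ) ^ d + p * r :=
    fun a b => by
      obtain ⟨r, hr⟩ := exists_add_pow_prime_pow_eq hp a b d
      exact ⟨a * b * r, by rw [hr]; ring⟩
  induction hf' using AddSubgroup.closure_induction with
  | zero => exact ⟨0, by simp [ghost_zero, hp.ne_zero]⟩
  | add x y _ _ hx hy =>
    obtain ⟨a, ha⟩ := hx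
    obtain ⟨b, hb⟩ := hy
    obtain ⟨r, hr⟩ := hadd (ghost x 1) (ghost y 1)
    refine ⟨a + b - r, ?_⟩
    rw [ghost_add, Pi.add_apply, Pi.add_apply, hr, ha, hb]
    ring
  | neg x _ hx =>
    obtain ⟨a, ha⟩ := hx
    -- Applying additivity to $a+(-a)=0$ avoids a sign case for $p=2$.
    obtain ⟨r, hr⟩ := hadd (ghost x 1) (-ghost x 1)
    rw [add_neg_cancel, zero_pow (pow_ne_zero _ hp.ne_zero)] at hr
    refine ⟨r - a, ?_⟩
    rw [← zero_sub x, ghost_sub, ghost_zero, Pi.sub_apply, Pi.sub_apply, ha, Pi.zero_apply,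
      Pi.zero_apply, zero_sub, zero_sub]
    linear_combination hr
  | mem x hx =>
    obtain ⟨j, u, hj, rfl⟩ := hx
    by_cases h1 : j = 1
    · subst h1
      exact ⟨0, by rw [ghost_elem_one, ghost_elem_one]; simp⟩
    · have h1' : (j : ℕ) ≠ 1 := by rwa [Ne, PNat.coe_eq_one_iff]
      have h2 : ghost (elem j u) 1 = 0 := by
        rw [ghost_elem]
        exact if_neg (by simpa using h1)
      rw [h2, zero_pow (pow_ne_zero _ hp.ne_zero), ghost_elem]
      split_ifs with hd
      · rw [PNat.pow_coe, Nat.dvd_prime_pow hp] at hd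
        obtain ⟨k, -, hk⟩ := hd
        obtain ⟨k, rfl⟩ := Nat.exists_eq_succ_of_ne_zero (n := k) (by rintro rfl; simp [h1'] at hk)
        rw [hk, pow_succ]
        refine ⟨(p : ℕ) ^ k * u ^ (((p ^ d : ℕ+) : ℕ) / (p ^ k * p)), ?_⟩
        push_cast
        ring
      · exact ⟨0, by simp⟩

open Classical in
/-- The indicator function of the products of `m₀` and a power of `p` is a ghost vector. -/
theorem exists_ghost_eq_indicator (p : ℕ+) (hp : (p : ℕ).Prime)
    (hR : ∀ n : ℕ, Nat.Coprime n p → IsUnit (n : R)) (m₀ : ℕ+) (hm₀ : Nat.Coprime m₀ p) :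
    ∃ e : Lambda R, ghost e = fun m => if ∃ k, m = m₀ * p ^ k then 1 else 0 := by
  apply exists_of_approx
  intro N
  have h1 : ∀ n : ℕ+, ∃ g : Lambda R, Nat.Coprime n p →
      ∀ m : ℕ+, ghost g m = if (n : ℕ) ∣ m then 1 else 0 := fun n => by
    by_cases hn : Nat.Coprime n p
    · obtain ⟨g, hg⟩ := exists_ghost_eq_indicator_dvd (R := R) n (hR n hn)
      exact ⟨g, fun _ => hg⟩
    · exact ⟨0, fun h => absurd h hn⟩
  choose δ hδ using h1
  obtain ⟨S, hS⟩ : ∃ S : Finset ℕ+, ∀ l : ℕ+, l ∈ S ↔ (l : ℕ) ≤ N + 1 ∧ (l : ℕ).Prime ∧ l ≠ p :=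
    ⟨(Finset.Icc 1 N.succPNat).filter fun l => (l : ℕ).Prime ∧ l ≠ p, fun l => by
      rw [Finset.mem_filter, Finset.mem_Icc, ← PNat.coe_le_coe l, Nat.succPNat_coe]
      simp⟩
  -- A sieve: keep the multiples of $m_0$ and discard those $m$ for which $m/m_0$ has a prime factor
  -- other than $p$. Up to $N$, finitely many primes suffice.
  refine ⟨δ m₀ * ∏ l ∈ S, (1 - δ (m₀ * l)), fun m hm => ?_⟩
  have hco : ∀ l ∈ S, Nat.Coprime ((m₀ * l : ℕ+) : ℕ) p := fun l hl => by
    obtain ⟨-, h2, h3⟩ := (hS l).1 hl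
    rw [PNat.mul_coe]
    exact Nat.Coprime.mul_left hm₀ ((Nat.coprime_primes h2 hp).2 fun h => h3 (PNat.eq h))
  have h2 : ∀ l ∈ S, ghost (1 - δ (m₀ * l)) m = 1 - if (m₀ : ℕ) * l ∣ m then 1 else 0 :=
    fun l hl => by
      rw [ghost_sub, ghost_one, Pi.sub_apply, hδ _ (hco l hl), PNat.mul_coe, Pi.one_apply]
  rw [ghost_mul, Pi.mul_apply, hδ m₀ hm₀, ghost_prod, Finset.prod_congr rfl h2]
  by_cases hd : (m₀ : ℕ) ∣ m
  · rw [if_pos hd, one_mul]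
    obtain ⟨k, hk⟩ := hd
    have hk0 : 0 < k := Nat.pos_of_ne_zero (by rintro rfl; have := m.pos; omega)
    split_ifs with h3
    · obtain ⟨i, rfl⟩ := h3
      refine Finset.prod_eq_one fun l hl => ?_
      rw [if_neg, sub_zero]
      intro h
      rw [PNat.mul_coe, Nat.mul_dvd_mul_iff_left m₀.pos, PNat.pow_coe] at h
      obtain ⟨-, h4, h5⟩ := (hS l).1 hl
      exact h5 (PNat.eq ((Nat.prime_dvd_prime_iff_eq h4 hp).1 (h4.dvd_of_dvd_pow h)))
    · by_contra h4
      refine h3 ⟨k.primeFactorsList.length, PNat.eq ?_⟩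
      rw [PNat.mul_coe, PNat.pow_coe, hk]
      congr 1
      refine Nat.eq_prime_pow_of_unique_prime_dvd hk0.ne' fun {l} hl hlk => ?_
      by_contra h5
      have hlm : (m₀ : ℕ) * l ∣ m := by rw [hk]; exact Nat.mul_dvd_mul_left _ hlk
      refine h4 (Finset.prod_eq_zero (i := ⟨l, hl.pos⟩) ((hS _).2 ⟨?_, hl, fun h => h5 ?_⟩) ?_)
      · exact ((Nat.le_of_dvd m.pos ((dvd_mul_left _ _).trans hlm)).trans hm).trans N.le_succ
      · rw [← h]
        rfl
      · rw [PNat.mk_coe, if_pos hlm, sub_self]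
  · rw [if_neg hd, zero_mul, if_neg]
    rintro ⟨k, rfl⟩
    exact hd (by rw [PNat.mul_coe]; exact dvd_mul_right _ _)

/-- If all the ghost components of index `p ^ k`, `k ≥ 1`, vanish, then the first one has divided
powers. -/
theorem exists_ghost_one_pow_eq (p : ℕ+) (hp : (p : ℕ).Prime)
    (hR : ∀ n : ℕ, Nat.Coprime n p → IsUnit (n : R)) (f : Lambda R) (j : ℕ)
    (h : ∀ k, 1 ≤ k → k ≤ j → ghost f (p ^ k) = 0) :
    ∃ r : R, ghost f 1 ^ (p : ℕ) ^ j = (((p : ℕ) ^ j).factorial : ℕ) * r := by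
  classical
  obtain ⟨e, he⟩ := exists_ghost_eq_indicator p hp hR 1 (by simp)
  have h1 : ghost (e * f) 1 = ghost f 1 := by
    rw [ghost_mul, Pi.mul_apply, he]
    dsimp only
    rw [if_pos ⟨0, by simp⟩, one_mul]
  -- The idempotent $e$ kills the components off the powers of $p$, so $ef$ is $\exp(-xT)$ up to
  -- degree $p^j$.
  have h2 := coeff_mul_factorial (e * f) ((p : ℕ) ^ j) (fun m hm hmj => by
    rw [ghost_mul, Pi.mul_apply, he]
    dsimp only
    split_ifs with hk
    · obtain ⟨k, rfl⟩ := hk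
      rw [one_mul] at hm hmj ⊢
      rw [one_mul, h k]
      · exact Nat.pos_of_ne_zero (by rintro rfl; simp at hm)
      · rw [PNat.pow_coe] at hmj
        exact (Nat.pow_le_pow_iff_right hp.one_lt).1 hmj
    · rw [zero_mul]) _ le_rfl
  rw [h1, neg_pow] at h2
  refine ⟨(-1) ^ (p : ℕ) ^ j * coeff ((p : ℕ) ^ j) (e * f).series, ?_⟩
  have h3 : ((-1 : R) ^ (p : ℕ) ^ j) * (-1) ^ (p : ℕ) ^ j = 1 := by
    rw [← mul_pow]
    simp
  linear_combination (-(-1 : R) ^ (p : ℕ) ^ j) * h2 - ghost f 1 ^ (p : ℕ) ^ j * h3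

end Prime

/-! ### The generator, and the leading coefficient of an element of the ideal -/

section Generator

variable {R : Type*} [CommRing R] [IsAddTorsionFree R]

/-- Since $\lfloor\log_p(D/(m_0p^k))\rfloor=\lfloor\log_p(D/m_0)\rfloor-k$, raising $k$ by one
raises the root of unity to the $p$-th power; on each class the components are thus those of one
$1-[\xi]$. -/
theorem exists_ghost_eq_one_sub_pow (p : ℕ+) (hp : (p : ℕ).Prime)
    (hR : ∀ n : ℕ, Nat.Coprime n p → IsUnit (n : R)) (D : ℕ) (z : R)
    (hz : z ^ (p : ℕ) ^ (Nat.log p D + 1) = 1) :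
    ∃ w : Lambda R, ∀ m : ℕ+, ghost w m =
      if (m : ℕ) ≤ D then 1 - z ^ (p : ℕ) ^ (Nat.log p D - Nat.log p (D / m)) else 0 := by
  classical
  have key : ∀ m₀ : ℕ+, ∃ v : Lambda R, (m₀ : ℕ) ≤ D → Nat.Coprime m₀ p → ∀ m : ℕ+,
      ghost v m = if (m : ℕ) ≤ D ∧ ∃ k, m = m₀ * p ^ k then
        1 - z ^ (p : ℕ) ^ (Nat.log p D - Nat.log p (D / m)) else 0 := by
    intro m₀
    by_cases hco : Nat.Coprime m₀ p
    swap
    · exact ⟨0, fun _ h => absurd h hco⟩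
    obtain ⟨e, he⟩ := exists_ghost_eq_indicator p hp hR m₀ hco
    -- An inverse $t$ of $m_0$ modulo the order of $z$ cancels the factor $m_0$ in the exponent
    -- $m=m_0p^k$.
    obtain ⟨t, -, ht⟩ := Nat.exists_mul_mod_eq_one_of_coprime
      (hco.pow_right (Nat.log p D + 1)) (one_lt_pow₀ hp.one_lt (Nat.succ_ne_zero _))
    have hzt : z ^ (m₀ * t : ℕ) = z := by
      rw [pow_eq_pow_mod _ hz, ht, pow_one]
    refine ⟨e * (1 - elem 1 ((z ^ t) ^ (p : ℕ) ^ (Nat.log p D - Nat.log p (D / m₀)))),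
      fun hD _ m => ?_⟩
    rw [ghost_mul, Pi.mul_apply, he, ghost_sub, Pi.sub_apply, ghost_one, Pi.one_apply,
      ghost_elem_one]
    dsimp only
    by_cases hk : ∃ k, m = m₀ * p ^ k
    swap
    · rw [if_neg hk, if_neg fun h => hk h.2, zero_mul]
    rw [if_pos hk, one_mul]
    obtain ⟨k, rfl⟩ := hk
    have hL : Nat.log p (D / m₀) ≤ Nat.log p D := Nat.log_mono_right (Nat.div_le_self _ _)
    have hpow : ((z ^ t) ^ (p : ℕ) ^ (Nat.log p D - Nat.log p (D / m₀))) ^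
        ((m₀ * p ^ k : ℕ+) : ℕ) = z ^ (p : ℕ) ^ (Nat.log p D - Nat.log p (D / m₀) + k) := by
      conv_rhs => rw [← hzt]
      rw [← pow_mul, ← pow_mul, ← pow_mul, PNat.mul_coe, PNat.pow_coe, pow_add]
      congr 1
      ring
    have hDm : D / ((m₀ * p ^ k : ℕ+) : ℕ) = D / m₀ / (p : ℕ) ^ k := by
      rw [Nat.div_div_eq_div_mul, PNat.mul_coe, PNat.pow_coe]
    rw [hpow]
    split_ifs with h
    · have h1 : (p : ℕ) ^ k ≤ D / m₀ := by
        rw [Nat.le_div_iff_mul_le m₀.pos, mul_comm]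
        simpa using h.1
      have h2 : k ≤ Nat.log p (D / m₀) := Nat.le_log_of_pow_le hp.one_lt h1
      rw [hDm, Nat.log_div_base_pow]
      congr 3
      omega
    -- Beyond $D$ the exponent of $p$ reaches $\lfloor\log_pD\rfloor+1$, so the root of unity
    -- becomes $1$.
    · have h0 : ¬ ((m₀ * p ^ k : ℕ+) : ℕ) ≤ D := fun h' => h ⟨h', k, rfl⟩
      have h1 : D / m₀ < (p : ℕ) ^ k := by
        rw [Nat.div_lt_iff_lt_mul m₀.pos, mul_comm]
        simpa using h0
      have h2 : Nat.log p (D / m₀) < k :=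
        Nat.log_lt_of_lt_pow (Nat.div_pos hD m₀.pos).ne' h1
      obtain ⟨i, hi⟩ := Nat.exists_eq_add_of_le
        (show Nat.log p D + 1 ≤ Nat.log p D - Nat.log p (D / m₀) + k by omega)
      rw [hi, pow_add _ (Nat.log p D + 1), pow_mul, hz, one_pow, sub_self]
  choose v hv using key
  refine ⟨∑ m₀ ∈ (Finset.Icc 1 D.succPNat).filter
    (fun m₀ : ℕ+ => (m₀ : ℕ) ≤ D ∧ Nat.Coprime m₀ p), v m₀, fun m => ?_⟩
  have hS : ∀ m₀ : ℕ+, m₀ ∈ (Finset.Icc 1 D.succPNat).filter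
      (fun m₀ : ℕ+ => (m₀ : ℕ) ≤ D ∧ Nat.Coprime m₀ p) ↔ (m₀ : ℕ) ≤ D ∧ Nat.Coprime m₀ p := by
    intro m₀
    rw [Finset.mem_filter, Finset.mem_Icc, ← PNat.coe_le_coe m₀, Nat.succPNat_coe,
      and_iff_right_iff_imp]
    exact fun h => ⟨one_le, h.1.trans D.le_succ⟩
  rw [ghost_sum, Finset.sum_congr rfl fun m₀ h => hv m₀ ((hS _).1 h).1 ((hS _).1 h).2 m]
  split_ifs with hm
  swap
  · exact Finset.sum_eq_zero fun m₀ _ => if_neg fun h => hm h.1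
  obtain ⟨k, m₁, hm₁, hmk⟩ := Nat.exists_eq_pow_mul_and_not_dvd m.ne_zero p hp.ne_one
  have hm0 : 0 < m₁ := Nat.pos_of_ne_zero (by rintro rfl; simp at hm₁)
  lift m₁ to ℕ+ using hm0
  have hco : Nat.Coprime m₁ p := ((Nat.Prime.coprime_iff_not_dvd hp).2 hm₁).symm
  have hmk' : m = m₁ * p ^ k := PNat.eq (by rw [hmk, PNat.mul_coe, PNat.pow_coe, mul_comm])
  rw [Finset.sum_eq_single_of_mem m₁ ((hS _).2 ⟨?_, hco⟩) ?_, if_pos ⟨hm, k, hmk'⟩]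
  · refine (Nat.le_of_dvd m.pos ?_).trans hm
    rw [hmk]
    exact dvd_mul_left _ _
  · intro m₀ hm₀ hne
    refine if_neg fun h => hne (PNat.eq ?_)
    obtain ⟨-, i, hi⟩ := h
    have hco' := ((hS _).1 hm₀).2
    have hmi : (m₁ : ℕ) * p ^ k = m₀ * p ^ i := by
      have := congrArg PNat.val (hmk'.symm.trans hi)
      simpa using this
    exact Nat.dvd_antisymm
      ((hco'.pow_right k).dvd_of_dvd_mul_right (hmi ▸ dvd_mul_right _ _))
      ((hco.pow_right i).dvd_of_dvd_mul_right (hmi ▸ dvd_mul_right _ _))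

/-- The `p ^ d`-th power of the leading coefficient of a series whose ghost components of index
`n * p ^ k` vanish for `k > d` has divided powers modulo `p`, up to a unit. -/
theorem exists_natCast_mul_pow_eq_add (p : ℕ+) (hp : (p : ℕ).Prime)
    (hR : ∀ n : ℕ, Nat.Coprime n p → IsUnit (n : R)) (f : Lambda R) (n : ℕ+) (d : ℕ)
    (h₀ : ∀ m < n, ghost f m = 0) (h₁ : ∀ k, d < k → ghost f (n * p ^ k) = 0) (c : R)
    (hc : ghost f n = n * c) :
    ∃ (u : ℕ) (x r : R), Nat.Coprime u p ∧ (u * c) ^ (p : ℕ) ^ d = x + p * r ∧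
      ∀ j : ℕ, ∃ s, x ^ (p : ℕ) ^ j = (((p : ℕ) ^ j).factorial : ℕ) * s := by
  obtain ⟨a, n₀, hn₀, hna⟩ := Nat.exists_eq_pow_mul_and_not_dvd n.ne_zero p hp.ne_one
  have hm0 : 0 < n₀ := Nat.pos_of_ne_zero (by rintro rfl; simp at hn₀)
  lift n₀ to ℕ+ using hm0
  have hco : Nat.Coprime n₀ p := ((Nat.Prime.coprime_iff_not_dvd hp).2 hn₀).symm
  obtain rfl : n = n₀ * p ^ a :=
    PNat.eq (by rw [hna, PNat.mul_coe, PNat.pow_coe, mul_comm])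
  have hpa : (p : ℕ) ^ a ≠ 0 := pow_ne_zero _ hp.ne_zero
  -- Each `h j` is controlled only up to $p^{d+j}$; the different `h j` agree at $p^d$ because $p^a$
  -- cancels.
  choose h hh using fun j => exists_ghost_prime_pow_eq p hp f n₀ a hco h₀ (d + j)
  obtain ⟨r, hr⟩ := exists_ghost_prime_pow_eq_pow_add p hp (h 0) d
  refine ⟨n₀, ghost (h 0) (p ^ d), -r, hco, ?_, fun j => ?_⟩
  · have h1 : ghost (h 0) 1 = n₀ * c := by
      apply natCast_mul_cancel hpa
      have := hh 0 0 (by omega)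
      rw [pow_zero, add_zero, hc] at this
      rw [this]
      push_cast
      ring
    rw [← h1, hr]
    ring
  -- Frobenius moves the component at $p^d$ to index $1$ and those beyond it, which vanish, to
  -- $p,p^2,\dots,p^j$.
  · obtain ⟨g, hg⟩ := exists_ghost_eq_ghost_mul (h j) (p ^ d)
    have h1 : ghost g 1 = ghost (h 0) (p ^ d) := by
      rw [hg]
      apply natCast_mul_cancel hpa
      dsimp only
      rw [mul_one, hh j d (by omega), hh 0 d (by omega)]
    rw [← h1]
    refine exists_ghost_one_pow_eq p hp hR g j fun k hk hkj => ?_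
    rw [hg]
    apply natCast_mul_cancel hpa
    dsimp only
    rw [← pow_add, hh j (d + k) (by omega), mul_zero, pow_add, ← mul_assoc, pow_add, ← mul_assoc,
      mul_assoc, ← pow_add]
    exact h₁ _ (by omega)

end Generator

end Lambda

/-! ### Norms of integers, factorials and roots of unity -/

section NormNatCast

variable {K : Type*} [NormedField K] (p : ℕ) [hp : Fact p.Prime] [NormedAlgebra ℚ_[p] K]

theorem norm_natCast_eq_padic (n : ℕ) : ‖(n : K)‖ = ‖(n : ℚ_[p])‖ := by
  rw [← norm_algebraMap' K (n : ℚ_[p]), map_natCast]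

theorem norm_natCast_prime : ‖(p : K)‖ = (p : ℝ)⁻¹ := by
  rw [norm_natCast_eq_padic p, Padic.norm_p]

theorem norm_natCast_of_coprime {n : ℕ} (hn : n.Coprime p) : ‖(n : K)‖ = 1 := by
  rw [norm_natCast_eq_padic p, Padic.norm_natCast_eq_one_iff]
  exact hn.symm

/-- Legendre's formula $(p-1)\,v_p((p^j)!)=p^j-1$, with the subtraction cleared. -/
theorem norm_factorial_prime_pow (j : ℕ) :
    ‖((p ^ j).factorial : K)‖ ^ (p - 1) * (p : ℝ) ^ p ^ j = p := by
  have hp0 : (p : ℝ) ≠ 0 := Nat.cast_ne_zero.2 hp.out.ne_zero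
  have h1 := sub_one_mul_padicValNat_factorial (p := p) (p ^ j)
  have h2 : (p.digits (p ^ j)).sum = 1 := by
    have := Nat.digits_base_pow_mul (k := j) hp.out.one_lt one_pos
    rw [mul_one] at this
    rw [this, Nat.digits_of_lt p 1 one_ne_zero hp.out.one_lt]
    simp
  rw [h2] at h1
  have h3 : 0 < p ^ j := pow_pos hp.out.pos j
  rw [norm_natCast_eq_padic p, Padic.norm_eq_zpow_neg_valuation
    (Nat.cast_ne_zero.2 (Nat.factorial_ne_zero _)), Padic.valuation_natCast, zpow_neg,
    zpow_natCast, inv_pow, ← pow_mul, mul_comm _ (p - 1), h1, inv_mul_eq_iff_eq_mul₀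
    (pow_ne_zero _ hp0), ← pow_succ, Nat.sub_add_cancel h3]

end NormNatCast

section Norm

variable {K : Type*} [NormedField K] [IsUltrametricDist K]

theorem mem_integers_iff (x : K) : x ∈ integers K ↔ ‖x‖ ≤ 1 := by
  rw [Valuation.mem_integer_iff, NormedField.valuation_apply, ← NNReal.coe_le_coe, coe_nnnorm,
    NNReal.coe_one]

theorem norm_integers_le (x : integers K) : ‖(x : K)‖ ≤ 1 := (mem_integers_iff _).1 x.2

theorem integers_dvd_iff (x y : integers K) : x ∣ y ↔ ‖(y : K)‖ ≤ ‖(x : K)‖ := by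
  constructor
  · rintro ⟨z, rfl⟩
    rw [Subring.coe_mul, norm_mul]
    exact mul_le_of_le_one_right (norm_nonneg _) (norm_integers_le z)
  · intro h
    by_cases hx : (x : K) = 0
    · rw [hx, norm_zero, norm_le_zero_iff] at h
      exact ⟨0, Subtype.ext (by simp [h])⟩
    · refine ⟨⟨(y : K) / x, (mem_integers_iff _).2 ?_⟩, Subtype.ext ?_⟩
      · rw [norm_div]
        exact div_le_one_of_le₀ h (norm_nonneg _)
      · exact (mul_div_cancel₀ _ hx).symm

variable (p : ℕ) [hp : Fact p.Prime] [NormedAlgebra ℚ_[p] K]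

theorem isUnit_natCast_of_coprime {n : ℕ} (hn : n.Coprime p) : IsUnit (n : integers K) := by
  rw [isUnit_iff_dvd_one, integers_dvd_iff]
  simp [norm_natCast_of_coprime p hn]

/-- An element with divided powers has norm at most `p ^ (-1 / (p - 1))`. -/
theorem norm_pow_le_of_factorial_dvd (x : integers K)
    (hx : ∀ j : ℕ, ∃ s, x ^ p ^ j = ((p ^ j).factorial : ℕ) * s) :
    ‖(x : K)‖ ^ (p - 1) ≤ (p : ℝ)⁻¹ := by
  have hp0 : (0 : ℝ) < p := Nat.cast_pos.2 hp.out.pos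
  rw [← one_div, le_div_iff₀ hp0]
  -- If $|x|^{p-1}p>1$, its $p^j$-th power exceeds $p$ for large $j$, whereas divisibility by
  -- $(p^j)!$ bounds it by $p$.
  by_contra! h
  obtain ⟨j, hj⟩ := pow_unbounded_of_one_lt (p : ℝ) h
  have h1 := hj.trans_le (pow_le_pow_right₀ h.le (Nat.lt_pow_self hp.out.one_lt (n := j)).le)
  obtain ⟨s, hs⟩ := hx j
  have h2 : ‖(x : K)‖ ^ p ^ j ≤ ‖((p ^ j).factorial : K)‖ := by
    rw [← norm_pow, ← Subring.coe_pow, hs]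
    simpa using mul_le_of_le_one_right (norm_nonneg ((p ^ j).factorial : K)) (norm_integers_le s)
  have h3 := pow_le_pow_left₀ (by positivity) h2 (p - 1)
  rw [mul_pow, ← pow_mul, mul_comm (p - 1), pow_mul] at h1
  have h4 := mul_le_mul_of_nonneg_right h3 (pow_pos hp0 (p ^ j)).le
  rw [norm_factorial_prime_pow] at h4
  linarith

/-- Evaluate $\Phi_{p^{d+1}}(1)=p$ as $\prod(1-\mu)$. Primitive roots are powers of one another, so
the $p^d(p-1)$ factors divide each other and have equal norm. -/
theorem norm_one_sub_pow_eq {d : ℕ} (ξ : integers K) (hξ : IsPrimitiveRoot ξ (p ^ (d + 1))) :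
    ‖((1 - ξ : integers K) : K)‖ ^ (p ^ d * (p - 1)) = (p : ℝ)⁻¹ := by
  have h1 := Polynomial.eval_one_cyclotomic_prime_pow (R := integers K) (p := p) d
  rw [Polynomial.cyclotomic_eq_prod_X_sub_primitiveRoots hξ, Polynomial.eval_prod] at h1
  have h2 := congrArg (fun x : integers K => ‖(x : K)‖) h1
  have hn : NeZero (p ^ (d + 1)) := ⟨pow_ne_zero _ hp.out.ne_zero⟩
  simp only [Polynomial.eval_sub, Polynomial.eval_X, Polynomial.eval_C] at h2
  rw [← Subring.subtype_apply, map_prod, norm_prod, Finset.prod_congr rfl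
    (g := fun _ => ‖((1 - ξ : integers K) : K)‖), Finset.prod_const, hξ.card_primitiveRoots,
    Nat.totient_prime_pow_succ hp.out] at h2
  · rw [h2]
    simpa using norm_natCast_prime (K := K) p
  · intro μ hμ
    have hμ' := isPrimitiveRoot_of_mem_primitiveRoots hμ
    apply le_antisymm
    · obtain ⟨i, -, rfl⟩ := hξ.eq_pow_of_pow_eq_one hμ'.pow_eq_one
      exact (integers_dvd_iff _ _).1 (one_sub_dvd_one_sub_pow ξ i)
    · obtain ⟨i, -, rfl⟩ := hμ'.eq_pow_of_pow_eq_one hξ.pow_eq_one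
      exact (integers_dvd_iff _ _).1 (one_sub_dvd_one_sub_pow μ i)

/-- The error $pr$ is harmless: by the ultrametric inequality the norm is at most $\max(|x|,1/p)$,
and $1/p\le p^{-1/(p-1)}$. -/
theorem norm_pow_le_of_pow_eq_add {d u : ℕ} (hu : u.Coprime p) (c x r : integers K)
    (h : (u * c) ^ p ^ d = x + p * r)
    (hx : ∀ j : ℕ, ∃ s, x ^ p ^ j = ((p ^ j).factorial : ℕ) * s) :
    ‖(c : K)‖ ^ (p ^ d * (p - 1)) ≤ (p : ℝ)⁻¹ := by
  have hp1 : (1 : ℝ) ≤ p := Nat.one_le_cast.2 hp.out.one_le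
  have hinv : (p : ℝ)⁻¹ ^ (p - 1) ≤ (p : ℝ)⁻¹ :=
    pow_le_of_le_one (by positivity) (inv_le_one_of_one_le₀ hp1)
      (by have := hp.out.two_le; omega)
  have h1 := congrArg (fun x : integers K => ‖(x : K)‖) h
  simp only [Subring.coe_pow, Subring.coe_mul, Subring.coe_add, Subring.coe_natCast, norm_pow,
    norm_mul, norm_natCast_of_coprime p hu, one_mul] at h1
  rw [pow_mul, h1]
  have h2 := IsUltrametricDist.norm_add_le_max (x : K) (p * r)
  rcases le_max_iff.1 h2 with h3 | h3
  · exact (pow_le_pow_left₀ (norm_nonneg _) h3 _).trans (norm_pow_le_of_factorial_dvd p x hx)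
  · refine (pow_le_pow_left₀ (norm_nonneg _) h3 _).trans (le_trans ?_ hinv)
    refine pow_le_pow_left₀ (norm_nonneg _) ?_ _
    rw [norm_mul, norm_natCast_prime p]
    exact mul_le_of_le_one_right (by positivity) (norm_integers_le r)

end Norm

namespace Lambda

open PowerSeries

/-! ### The annihilator of the generator and membership in its ideal -/

section Ideal

theorem mul_eq_zero_iff_mem_tail {K : Type*} [NormedField K] [CharZero K] [IsUltrametricDist K]
    (p : ℕ) [hp : Fact p.Prime] (D : ℕ) (ζ : integers K)
    (hζ : IsPrimitiveRoot ζ (p ^ (Nat.log p D + 1))) (w : Lambda (integers K))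
    (hw : ∀ m : ℕ+, ghost w m =
      if (m : ℕ) ≤ D then 1 - ζ ^ p ^ (Nat.log p D - Nat.log p (D / m)) else 0)
    (a : Lambda (integers K)) : a * w = 0 ↔ a ∈ tail (integers K) D := by
  change _ ↔ X ^ (D + 1) ∣ a.series - 1
  rw [← ghost_eq_zero_iff, ← ghost_injective.eq_iff, ghost_mul, ghost_zero, funext_iff]
  refine forall_congr' fun m => ?_
  rw [Pi.mul_apply, Pi.zero_apply, hw]
  split_ifs with hm
  · rw [mul_eq_zero, or_iff_left]
    · simp [hm]
    -- The exponent $p^{L-d_m}$, $L=\lfloor\log_pD\rfloor$, is smaller than the order $p^{L+1}$ of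
    -- $\zeta$.
    · refine sub_ne_zero.2 fun h => ?_
      have h1 := (hζ.pow_eq_one_iff_dvd _).1 h.symm
      have h2 := (Nat.pow_dvd_pow_iff_le_right hp.out.one_lt).1 h1
      omega
  · simp [hm]

variable {K : Type*} [NormedField K] [CharZero K] [IsUltrametricDist K]
  (p : ℕ) [hp : Fact p.Prime] [NormedAlgebra ℚ_[p] K]

/-- Divisibility by a series with ghost components `1 - ζ_{d_m}` for `m ≤ D` and `0` beyond. -/
theorem mem_span_of_ghost_eq_zero (D : ℕ) (ζ : integers K)
    (hζ : IsPrimitiveRoot ζ (p ^ (Nat.log p D + 1))) (w : Lambda (integers K))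
    (hw : ∀ m : ℕ+, ghost w m =
      if (m : ℕ) ≤ D then 1 - ζ ^ p ^ (Nat.log p D - Nat.log p (D / m)) else 0)
    (f : Lambda (integers K)) (hf : ∀ m : ℕ+, D < m → ghost f m = 0) :
    f ∈ Ideal.span {w} := by
  have hz : ∀ g ∈ Ideal.span {w}, ∀ m : ℕ+, D < m → ghost g m = 0 := by
    intro g hg m hm
    obtain ⟨a, rfl⟩ := Ideal.mem_span_singleton'.1 hg
    rw [ghost_mul, Pi.mul_apply, hw, if_neg (by omega), mul_zero]
  obtain ⟨g, hg, hgf⟩ := exists_mem_ghost_eq (Submodule.toAddSubgroup (Ideal.span {w})) f 0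
    (fun m hm => absurd m.pos (by omega)) (fun n _ g hg hzero => by
      have hfg : ∀ m : ℕ+, D < m → ghost (f - g) m = 0 := fun m hm => by
        rw [ghost_sub, Pi.sub_apply, hf m hm, hz g hg m hm, sub_self]
      by_cases hn : (n : ℕ) ≤ D
      swap
      · refine ⟨0, zero_mem _, fun m hm => ?_⟩
        rw [ghost_zero, Pi.zero_apply]
        rcases hm.lt_or_eq with hm | rfl
        · exact (hzero m hm).symm
        · exact (hfg m (by omega)).symm
      obtain ⟨c, hc⟩ := exists_ghost_eq_natCast_mul _ n hzero
      set d := Nat.log p (D / n) with hd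
      have hdD : d ≤ Nat.log p D := Nat.log_mono_right (Nat.div_le_self _ _)
      let P : ℕ+ := ⟨p, hp.out.pos⟩
      obtain ⟨u, x, r, hu, hcx, hx⟩ := exists_natCast_mul_pow_eq_add P hp.out
        (fun _ h => isUnit_natCast_of_coprime p h) (f - g) n d hzero (fun k hk => hfg _ (by
          have h1 : D / n < p ^ k := Nat.lt_pow_of_log_lt hp.out.one_lt hk
          rw [Nat.div_lt_iff_lt_mul n.pos, mul_comm] at h1
          rw [PNat.mul_coe, PNat.pow_coe]
          exact h1)) c hc
      have hbound := norm_pow_le_of_pow_eq_add p hu c x r hcx hx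
      have hprim : IsPrimitiveRoot (ζ ^ p ^ (Nat.log p D - d)) (p ^ (d + 1)) :=
        hζ.pow (pow_pos hp.out.pos _) (by rw [← pow_add]; congr 1; omega)
      rw [← norm_one_sub_pow_eq p _ hprim] at hbound
      obtain ⟨v, hv⟩ := (integers_dvd_iff (1 - ζ ^ p ^ (Nat.log p D - d)) c).2
        (le_of_pow_le_pow_left₀ (mul_ne_zero (pow_ne_zero _ hp.out.ne_zero)
          (by have := hp.out.two_le; omega)) (norm_nonneg _) hbound)
      -- With $c=(1-\zeta_d)v$, the $n$-th component of this multiple is $nv(1-\zeta_d)=nc$, and the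
      -- earlier ones vanish.
      refine ⟨elem n v * w, Ideal.mul_mem_left _ _ (Ideal.mem_span_singleton_self w),
        fun m hm => ?_⟩
      rw [ghost_mul, Pi.mul_apply]
      rcases hm.lt_or_eq with hm | rfl
      · rw [ghost_elem_of_lt hm, hzero m hm, zero_mul]
      · rw [ghost_elem_self, hw, if_pos hn, hc, hv]
        ring) D
  suffices hfg : ghost f = ghost g by
    rw [ghost_injective hfg]
    exact hg
  funext m
  by_cases hm : (m : ℕ) ≤ D
  · exact (hgf m hm).symm
  · rw [hf m (by omega), hz g hg m (by omega)]

end Ideal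

/-! ### Exponentials of polynomials through ghost components -/

section ExpPoly

theorem constantCoeff_expPoly {K : Type*} [Field K] [CharZero K] (P : Polynomial K)
    (hP : P.coeff 0 = 0) : constantCoeff (expPoly P) = 1 := by
  have h0 : constantCoeff (P : PowerSeries K) = 0 := by simpa using hP
  have hs : HasSubst (P : PowerSeries K) := HasSubst.of_constantCoeff_zero' h0
  have h1 : expPoly P = (exp K - 1).subst (P : PowerSeries K) + 1 := by
    rw [expPoly, ← coe_substAlgHom hs, map_sub, map_one, sub_add_cancel]
  have h2 : constantCoeff ((exp K - 1).subst (P : PowerSeries K)) = 0 :=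
    constantCoeff_subst_eq_zero h0 _ (by simp)
  rw [h1, map_add, h2, map_one, zero_add]

/-- The ghost components characterise the exponential of a polynomial. -/
theorem map_series_eq_expPoly_iff {R K : Type*} [CommRing R] [Field K] [CharZero K] (φ : R →+* K)
    (f : Lambda R) (P : Polynomial K) (hP : P.coeff 0 = 0) :
    PowerSeries.map φ f.series = expPoly P ↔ ∀ n : ℕ+, φ (ghost f n) = -(n * P.coeff n) := by
  have h0 : constantCoeff (P : PowerSeries K) = 0 := by simpa using hP
  have hs : HasSubst (P : PowerSeries K) := HasSubst.of_constantCoeff_zero' h0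
  let E : Lambda K := ⟨expPoly P, constantCoeff_expPoly P hP⟩
  let F : Lambda K := ⟨PowerSeries.map φ f.series, by
    rw [← coeff_zero_eq_constantCoeff_apply, coeff_map, coeff_zero_eq_constantCoeff_apply,
      f.constantCoeff_series, map_one]⟩
  -- The logarithmic derivative of $\exp(P)$ is $P'$.
  have hE : E.ghostSeries = -(X * derivative K (P : PowerSeries K)) := by
    apply ghostSeries_eq
    change _ * expPoly P = -(X * derivative K (expPoly P))
    rw [expPoly, derivative_subst hs, derivative_exp]
    ring
  have hF : F.ghostSeries = PowerSeries.map φ f.ghostSeries := by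
    apply ghostSeries_eq
    change _ * PowerSeries.map φ f.series = -(X * derivative K (PowerSeries.map φ f.series))
    rw [← map_mul, ghostSeries_mul, map_neg, map_mul, map_X]
    congr 2
    ext n
    simp [coeff_derivative]
  have hEg : ∀ n : ℕ+, ghost E n = -(n * P.coeff n) := fun n => by
    obtain ⟨k, hk⟩ := Nat.exists_eq_succ_of_ne_zero n.ne_zero
    rw [ghost, hE, hk, map_neg, coeff_succ_X_mul, coeff_derivative, Polynomial.coeff_coe]
    push_cast
    ring
  have hFg : ∀ n : ℕ+, ghost F n = φ (ghost f n) := fun n => by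
    rw [ghost, hF, coeff_map, ghost]
  calc _ ↔ F = E := by rw [Lambda.ext_iff]
    _ ↔ _ := by
      rw [← ghost_injective.eq_iff, funext_iff]
      simp only [hEg, hFg]

end ExpPoly

end Lambda

/-! ### Freeness and the main theorem -/

/-- A principal ideal is free of rank one over the quotient by its annihilator. -/
theorem Ideal.free_span_singleton_of_mul_eq_zero_iff {A : Type*} [CommRing A] (I : Ideal A) (w : A)
    (hI : I ≠ ⊤) (hw : ∀ a, a * w = 0 ↔ a ∈ I) :
    ∃ h : Module.IsTorsionBySet A (Ideal.span {w} : Ideal A) (I : Set A),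
      letI := h.module
      Module.Free (A ⧸ I) (Ideal.span {w} : Ideal A) ∧
        Module.finrank (A ⧸ I) (Ideal.span {w} : Ideal A) = 1 := by
  have h : Module.IsTorsionBySet A (Ideal.span {w} : Ideal A) (I : Set A) := by
    rintro ⟨x, hx⟩ ⟨a, ha⟩
    obtain ⟨b, rfl⟩ := Ideal.mem_span_singleton'.1 hx
    apply Subtype.ext
    change a * (b * w) = 0
    rw [mul_left_comm, (hw a).2 ha, mul_zero]
  refine ⟨h, ?_⟩
  let := h.module
  have : Nontrivial (A ⧸ I) := Ideal.Quotient.nontrivial_iff.2 hI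
  let g : (A ⧸ I) →ₗ[A ⧸ I] (Ideal.span {w} : Ideal A) :=
    LinearMap.toSpanSingleton _ _ ⟨w, Ideal.mem_span_singleton_self w⟩
  have hg : ∀ a : A, ((g (Ideal.Quotient.mk I a) : (Ideal.span {w} : Ideal A)) : A) = a * w :=
    fun a => rfl
  have hbij : Function.Bijective g := by
    constructor
    · rw [injective_iff_map_eq_zero]
      intro x hx
      obtain ⟨a, rfl⟩ := Ideal.Quotient.mk_surjective x
      rw [Ideal.Quotient.eq_zero_iff_mem, ← hw, ← hg, hx]
      rfl
    · rintro ⟨x, hx⟩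
      obtain ⟨b, rfl⟩ := Ideal.mem_span_singleton'.1 hx
      exact ⟨Ideal.Quotient.mk I b, Subtype.ext (hg b)⟩
  let e := LinearEquiv.ofBijective g hbij
  exact ⟨Module.Free.of_equiv e, by rw [← e.finrank_eq, Module.finrank_self]⟩

theorem Lambda.tail_ne_top {R : Type*} [CommRing R] [IsAddTorsionFree R] [Nontrivial R] {D : ℕ}
    (hD : 1 ≤ D) : Lambda.tail R D ≠ ⊤ := by
  rw [Ideal.ne_top_iff_one]
  intro h
  have h1 := (Lambda.ghost_eq_zero_iff (1 : Lambda R) D).2 h 1 hD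
  rw [Lambda.ghost_one] at h1
  exact one_ne_zero h1

theorem coeff_generatorExponent {K : Type*} [Field K] (p D : ℕ) (ζ : K) (n : ℕ) :
    (generatorExponent p D ζ).coeff n =
      if 1 ≤ n ∧ n ≤ D then (ζ ^ p ^ (Nat.log p D - Nat.log p (D / n)) - 1) / (n : K) else 0 := by
  simp [generatorExponent, Polynomial.finsetSum_coeff, Polynomial.coeff_monomial]

theorem mainTheorem4 (p : ℕ) [Fact p.Prime] {K : Type*} [NormedField K] [CharZero K]
    [NormedAlgebra ℚ_[p] K] [IsUltrametricDist K] (D : ℕ) (hD : 1 ≤ D)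
    (ζ : integers K) (hζ : IsPrimitiveRoot ζ (p ^ (Nat.log p D + 1))) :
    ∃ w : Lambda (integers K),
      PowerSeries.map (integers K).subtype w.series =
        expPoly (generatorExponent p D (ζ : K)) ∧
      ((Ideal.span {w} : Ideal (Lambda (integers K))) : Set (Lambda (integers K))) =
        {f | ∃ P : Polynomial K, P.natDegree ≤ D ∧ P.coeff 0 = 0 ∧
          PowerSeries.map (integers K).subtype f.series = expPoly P} ∧
      ∃ h : Module.IsTorsionBySet (Lambda (integers K))
          (Ideal.span {w} : Ideal (Lambda (integers K)))
          (Lambda.tail (integers K) D : Set (Lambda (integers K))),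
        letI := h.module
        Module.Free (Lambda (integers K) ⧸ Lambda.tail (integers K) D)
            (Ideal.span {w} : Ideal (Lambda (integers K))) ∧
          Module.finrank (Lambda (integers K) ⧸ Lambda.tail (integers K) D)
            (Ideal.span {w} : Ideal (Lambda (integers K))) = 1 := by

  obtain ⟨w, hw⟩ := Lambda.exists_ghost_eq_one_sub_pow (R := integers K)
    ⟨p, (Fact.out : p.Prime).pos⟩ (Fact.out : p.Prime)
    (fun _ h => isUnit_natCast_of_coprime p h) D ζ hζ.pow_eq_one
  simp only [PNat.mk_coe] at hw
  refine ⟨w, ?_, ?_, Ideal.free_span_singleton_of_mul_eq_zero_iff _ w (Lambda.tail_ne_top hD)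
    (Lambda.mul_eq_zero_iff_mem_tail p D ζ hζ w hw)⟩
  · rw [Lambda.map_series_eq_expPoly_iff _ _ _ (by simp [coeff_generatorExponent])]
    intro n
    have hn : ((n : ℕ) : K) ≠ 0 := Nat.cast_ne_zero.2 n.ne_zero
    have hn1 : 1 ≤ (n : ℕ) := n.pos
    rw [hw, coeff_generatorExponent]
    by_cases h : (n : ℕ) ≤ D
    · rw [if_pos h, if_pos ⟨hn1, h⟩, mul_div_cancel₀ _ hn]
      simp
    · rw [if_neg h, if_neg fun h' => h h'.2]
      simp
  · ext f
    simp only [SetLike.mem_coe, Set.mem_ofPred_eq]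
    constructor
    · intro hf
      obtain ⟨a, rfl⟩ := Ideal.mem_span_singleton'.1 hf
      -- The logarithm is recovered from the ghost components by dividing by $-n$; it stops at
      -- degree $D$ because those of $w$ do.
      let P : Polynomial K := ∑ n ∈ Finset.Icc 1 D, Polynomial.monomial n
        (-(((a * w).ghostSeries.coeff n : integers K) : K) / (n : K))
      have hPc : ∀ n, P.coeff n = if 1 ≤ n ∧ n ≤ D then
          -(((a * w).ghostSeries.coeff n : integers K) : K) / (n : K) else 0 := fun n => by
        simp [P, Polynomial.finsetSum_coeff, Polynomial.coeff_monomial]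
      have hP0 : P.coeff 0 = 0 := by simp [hPc]
      refine ⟨P, ?_, hP0, ?_⟩
      · rw [Polynomial.natDegree_le_iff_coeff_eq_zero]
        intro n hn
        rw [hPc, if_neg (by omega)]
      · rw [Lambda.map_series_eq_expPoly_iff _ _ _ hP0]
        intro n
        have hn : ((n : ℕ) : K) ≠ 0 := Nat.cast_ne_zero.2 n.ne_zero
        have hn1 : 1 ≤ (n : ℕ) := n.pos
        rw [hPc]
        by_cases h : (n : ℕ) ≤ D
        · rw [if_pos ⟨hn1, h⟩, mul_div_cancel₀ _ hn, neg_neg]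
          rfl
        · rw [if_neg fun h' => h h'.2, Lambda.ghost_mul, Pi.mul_apply, hw, if_neg h]
          simp
    · rintro ⟨P, hPD, hP0, hPf⟩
      rw [Lambda.map_series_eq_expPoly_iff _ _ _ hP0] at hPf
      refine Lambda.mem_span_of_ghost_eq_zero p D ζ hζ w hw f fun m hm => Subtype.ext ?_
      have := hPf m
      rw [Polynomial.coeff_eq_zero_of_natDegree_lt (hPD.trans_lt hm)] at this
      simpa using this
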